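/- **Theorem 1.8.** Let $V$ be a complex vector space with a symmetric bilinear form $(\cdot,\cdot)$ and a basis $\{v_i\}_{i\in\mathbb Z}$ such that $(v_i,v_j)=\delta_{i,-j}$ for all $i,j\in\mathbb Z$, and let $V'=\{w\in V\mid (w,v_0)=0\}$. For a complex vector space $W$ with a symmetric bilinear form let $C\ell\,W$ be its Clifford algebra, with relations $uw+wu=(u,w)1$ ($u,w\in W$); let $\mathrm{Pin}\,W$ be the subgroup of the group $(C\ell\,W)^\times$ of invertible elements generated by all $a$ with $aWa^{-1}=W$, and let $\mathrm{Spin}\,W$ be the intersection of $\mathrm{Pin}\,W$ with the even part of $C\ell\,W$. Through the canonical homomorphism $C\ell\,V'\to C\ell\,V$, the group $\mathrm{Spin}\,V'$ acts on every $C\ell\,V$-module. Let $U=\sum_{j<0}\mathbb C v_j+\mathbb C(1+\sqrt2\,v_0)\subset\mathbb C1+V$, let $F=C\ell\,V/(C\ell\,V)U$ (a left $C\ell\,V$-module), let $|0\rangle\in F$ be the image of $1$, and let $|1\rangle=v_1|0\rangle$. For $\nu\in\mathbb Z/2\mathbb Z$ put $$F_{\overline\nu}=\{f\in F\mid -\sqrt2\,v_0f=(-1)^\nu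 f\},\qquad O=\mathrm{Spin}\,V\,|0\rangle,\qquad O_{\overline\nu}=\mathrm{Spin}\,V'\,|\nu\rangle .$$ On $F\otimes_{\mathbb C}F$ consider the linear operators $$S'=\sum_{0\neq j\in\mathbb Z}v_j\otimes v_{-j},\qquad S=v_0\otimes v_0+S',$$ where only finitely many terms of the sum are nonzero on any given element of $F\otimes F$. (a) If $\tau\in F$ and $\tau\neq0$, then $\tau\in O$ if and only if $S(\tau\otimes\tau)=\tfrac12\,\tau\otimes\tau$. (b) If $\nu\in\mathbb Z/2\mathbb Z$, $\tau\in F_{\overline\nu}$ and $\tau\neq0$, then $\tau\in O_{\overline\nu}$ if and only if $S'(\tau\otimes\tau)=0$. -/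

import Mathlib

open scoped TensorProduct

namespace SpinModule

noncomputable section

/-! ### Pin and Spin groups of a symmetric bilinear form -/

section Groups

variable {V : Type*} [AddCommGroup V] [Module ℂ V]

/-- The quadratic form `u ↦ (u, u) / 2`. Its Clifford algebra is the one with the relations
`u v + v u = (u, v) 1` when `B = (·, ·)` is symmetric. -/
abbrev halfForm (B : LinearMap.BilinForm ℂ V) : QuadraticForm ℂ V :=
  (1 / 2 : ℂ) • LinearMap.BilinMap.toQuadraticMap B

/-- The Clifford algebra `Cℓ V`. -/
abbrev Cl (B : LinearMap.BilinForm ℂ V) : Type _ := CliffordAlgebra (halfForm B)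

/-- The inclusion of `V` in `Cℓ V`. -/
abbrev vec (B : LinearMap.BilinForm ℂ V) : V →ₗ[ℂ] Cl B := CliffordAlgebra.ι (halfForm B)

theorem vec_mul_vec_add_swap (B : LinearMap.BilinForm ℂ V) (hB : B.IsSymm) (u w : V) :
    vec B u * vec B w + vec B w * vec B u = algebraMap ℂ (Cl B) (B u w) := by
  rw [CliffordAlgebra.ι_mul_ι_add_swap]
  congr 1
  have h : B w u = B u w := by simpa using hB.eq w u
  simp only [QuadraticMap.polar, smul_apply, LinearMap.BilinMap.toQuadraticMap_apply,
    map_add, LinearMap.add_apply, smul_eq_mul, h]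
  ring

/-- `Pin V`: the subgroup of `(Cℓ V)ˣ` generated by all `a` such that `a V a⁻¹ = V`. -/
def pin (B : LinearMap.BilinForm ℂ V) : Subgroup (Cl B)ˣ :=
  Subgroup.closure
    {a | (fun x : Cl B => (a : Cl B) * x * ((a⁻¹ : (Cl B)ˣ) : Cl B)) '' Set.range (vec B)
      = Set.range (vec B)}

theorem inv_mem_even (B : LinearMap.BilinForm ℂ V) (a : (Cl B)ˣ)
    (ha : (a : Cl B) ∈ CliffordAlgebra.even (halfForm B)) :
    ((a⁻¹ : (Cl B)ˣ) : Cl B) ∈ CliffordAlgebra.even (halfForm B) := by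
  have hfix : CliffordAlgebra.involute ((a⁻¹ : (Cl B)ˣ) : Cl B) = ((a⁻¹ : (Cl B)ˣ) : Cl B) := by
    have h1 : CliffordAlgebra.involute (a : Cl B) = a :=
      CliffordAlgebra.involute_eq_of_mem_even ha
    have h2 : CliffordAlgebra.involute ((a⁻¹ : (Cl B)ˣ) : Cl B) * (a : Cl B) = 1 := by
      have h3 := congrArg CliffordAlgebra.involute (Units.inv_mul a)
      rwa [map_mul, map_one, h1] at h3
    exact Units.eq_inv_of_mul_eq_one_right h2
  obtain ⟨x, hx, y, hy, hxy⟩ := Submodule.mem_sup.mp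
    ((CliffordAlgebra.evenOdd_isCompl (Q := halfForm B)).sup_eq_top ▸
      Submodule.mem_top (x := ((a⁻¹ : (Cl B)ˣ) : Cl B)))
  rw [← hxy, map_add, CliffordAlgebra.involute_eq_of_mem_even hx,
    CliffordAlgebra.involute_eq_of_mem_odd hy] at hfix
  have hy0 : y = 0 := by
    have h := add_left_cancel hfix
    have h2 : (2 : ℂ) • y = 0 := by rw [two_smul]; nth_rewrite 1 [← h]; exact neg_add_cancel y
    exact (smul_eq_zero.mp h2).resolve_left two_ne_zero
  rw [← hxy, hy0, add_zero]
  exact hx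

/-- `Spin V`: the intersection of `Pin V` with the even part of `Cℓ V`. -/
def spin (B : LinearMap.BilinForm ℂ V) : Subgroup (Cl B)ˣ where
  carrier := {a | a ∈ pin B ∧ (a : Cl B) ∈ CliffordAlgebra.even (halfForm B)}
  mul_mem' ha hb := ⟨mul_mem ha.1 hb.1, mul_mem ha.2 hb.2⟩
  one_mem' := ⟨one_mem _, one_mem _⟩
  inv_mem' ha := ⟨inv_mem ha.1, inv_mem_even B _ ha.2⟩

/-- The canonical homomorphism `Cℓ W → Cℓ V` for a subspace `W` of `V` with the restricted form. -/
def clIncl (B : LinearMap.BilinForm ℂ V) (W : Submodule ℂ V) : Cl (B.restrict W) →ₐ[ℂ] Cl B :=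
  CliffordAlgebra.map
    { toLinearMap := W.subtype
      map_app' := fun w => by simp [LinearMap.BilinForm.restrict, LinearMap.domRestrict₁₂_apply] }

/-- `Spin W`, regarded as a subgroup of `(Cℓ V)ˣ`, for a subspace `W` of `V`. -/
def spinSub (B : LinearMap.BilinForm ℂ V) (W : Submodule ℂ V) : Subgroup (Cl B)ˣ :=
  (spin (B.restrict W)).map (Units.map (clIncl B W : Cl (B.restrict W) →* Cl B))

end Groups

/-! ### The spin module -/

section Module

variable {V : Type*} [AddCommGroup V] [Module ℂ V]

/-- `(v_i, v_j) = δ_{i, -j}` for all integers `i`, `j`. -/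
def IsSplitBasis (B : LinearMap.BilinForm ℂ V) (v : Module.Basis ℤ ℂ V) : Prop :=
  ∀ i j : ℤ, B (v i) (v j) = if i = -j then 1 else 0

theorem IsSplitBasis.isSymm {B : LinearMap.BilinForm ℂ V} {v : Module.Basis ℤ ℂ V}
    (hv : IsSplitBasis B v) : B.IsSymm := by
  have h : B = B.flip := by
    refine v.ext fun i => v.ext fun j => ?_
    rw [LinearMap.BilinForm.flip_apply, hv i j, hv j i]
    congr 1
    exact propext ⟨fun h => by omega, fun h => by omega⟩
  exact ⟨fun x y => by
    simpa using LinearMap.congr_fun (LinearMap.congr_fun h x) y⟩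

variable (B : LinearMap.BilinForm ℂ V) (v : Module.Basis ℤ ℂ V)

/-- The isotropic subspace `U₀` of `V` spanned by the `v_j` with `j < 0`. -/
def U₀ : Submodule ℂ V := Submodule.span ℂ (v '' Set.Iio 0)

/-- The subspace `U = U₀ + ℂ (1 + √2 v₀)` of `ℂ 1 + V`. -/
def U : Submodule ℂ (Cl B) :=
  (U₀ v).map (vec B) ⊔ Submodule.span ℂ {1 + (Real.sqrt 2 : ℂ) • vec B (v 0)}

/-- The left ideal `(Cℓ V) U`. -/
def leftIdeal : Submodule (Cl B) (Cl B) := Submodule.span (Cl B) (U B v : Set (Cl B))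

/-- The quotient of a module by a submodule (no commutativity or two-sidedness is needed). -/
abbrev ModQuot {A M : Type*} [Ring A] [AddCommGroup M] [Module A M] (I : Submodule A M) : Type _ :=
  M ⧸ I

/-- The spin module `F = Cℓ V / (Cℓ V) U`, a left module over `Cℓ V`. -/
def F : Type _ := ModQuot (leftIdeal B v)

instance : AddCommGroup (F B v) := inferInstanceAs (AddCommGroup (ModQuot (leftIdeal B v)))

instance : Module (Cl B) (F B v) := inferInstanceAs (Module (Cl B) (ModQuot (leftIdeal B v)))

instance : Module ℂ (F B v) := inferInstanceAs (Module ℂ (ModQuot (leftIdeal B v)))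

instance : IsScalarTower ℂ (Cl B) (F B v) :=
  inferInstanceAs (IsScalarTower ℂ (Cl B) (ModQuot (leftIdeal B v)))

/-- The projection `Cℓ V → F`. -/
def proj : Cl B →ₗ[Cl B] F B v := (leftIdeal B v).mkQ

theorem proj_surjective : Function.Surjective (proj B v) := (leftIdeal B v).mkQ_surjective

theorem proj_eq_zero_iff (x : Cl B) : proj B v x = 0 ↔ x ∈ leftIdeal B v :=
  Submodule.Quotient.mk_eq_zero _

/-- The vacuum vector `|0⟩`, the image of `1`. -/
def vac : F B v := proj B v 1

/-- The action of a vector `u` of `V` on `F`. -/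
abbrev act (u : V) : F B v →ₗ[ℂ] F B v := Algebra.lsmul ℂ ℂ (F B v) (vec B u)

/-- The hyperplane `V'` of the vectors orthogonal to `v₀`. -/
def V' : Submodule ℂ V := LinearMap.ker (B.flip (v 0))

variable {B v} in
theorem mem_V' {w : V} : w ∈ V' B v ↔ B w (v 0) = 0 := by
  rw [V', LinearMap.mem_ker, LinearMap.BilinForm.flip_apply]

/-- `|0⟩` and `|1⟩ = v₁ |0⟩`. -/
def vacuum (ν : ZMod 2) : F B v := if ν = 0 then vac B v else act B v (v 1) (vac B v)

/-- The half spin module `F_ν = {f | -√2 v₀ f = (-1)^ν f}`. -/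
def halfSpin (ν : ZMod 2) : Submodule ℂ (F B v) where
  carrier := {f | -(Real.sqrt 2 : ℂ) • act B v (v 0) f = (-1 : ℂ) ^ ν.val • f}
  add_mem' {a b} ha hb := by
    simp only [Set.mem_ofPred_eq] at *
    rw [map_add, smul_add, smul_add, ha, hb]
  zero_mem' := by simp
  smul_mem' c a ha := by
    simp only [Set.mem_ofPred_eq] at *
    rw [map_smul, smul_comm, ha, smul_comm]

/-- The orbit `O = Spin V |0⟩`. -/
def orbit : Set (F B v) := MulAction.orbit (spin B) (vac B v)

/-- The orbit `O_ν = Spin V' |ν⟩`. -/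
def orbit' (ν : ZMod 2) : Set (F B v) :=
  MulAction.orbit (spinSub B (V' B v)) (vacuum B v ν)

variable {B v}

theorem act_proj (u : V) (x : Cl B) : act B v u (proj B v x) = proj B v (vec B u * x) :=
  ((proj B v).map_smul (vec B u) x).symm

theorem act_vac_of_neg {j : ℤ} (hj : j < 0) : act B v (v j) (vac B v) = 0 := by
  rw [vac, act_proj, mul_one, proj_eq_zero_iff]
  refine Submodule.subset_span (Submodule.mem_sup_left (Submodule.mem_map_of_mem ?_))
  exact Submodule.subset_span ⟨j, hj, rfl⟩

theorem act_act_add_swap (hB : B.IsSymm) (u w : V) (f : F B v) :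
    act B v u (act B v w f) + act B v w (act B v u f) = B u w • f := by
  have h := congrArg (fun x : Cl B => x • f) (vec_mul_vec_add_swap B hB u w)
  simpa [add_smul, mul_smul] using h

/-- Every vector of `F` is killed by `v_j` for `j` negative enough. -/
theorem exists_act_eq_zero (hv : IsSplitBasis B v) (f : F B v) :
    ∃ N : ℕ, ∀ j : ℤ, j < -(N : ℤ) → act B v (v j) f = 0 := by
  have hform : ∀ m : V, ∃ N : ℕ, ∀ j : ℤ, j < -(N : ℤ) → B (v j) m = 0 := by
    intro m
    induction v.mem_span m using Submodule.span_induction with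
    | zero => exact ⟨0, fun j _ => map_zero _⟩
    | mem x hx =>
      obtain ⟨i, rfl⟩ := hx
      refine ⟨i.natAbs, fun j hj => ?_⟩
      rw [hv, if_neg (by omega)]
    | add x y _ _ hx hy =>
      obtain ⟨M, hM⟩ := hx
      obtain ⟨N, hN⟩ := hy
      refine ⟨max M N, fun j hj => ?_⟩
      rw [map_add, hM j (by omega), hN j (by omega), add_zero]
    | smul c x _ hx =>
      obtain ⟨M, hM⟩ := hx
      exact ⟨M, fun j hj => by rw [map_smul, hM j hj, smul_zero]⟩
  obtain ⟨x, rfl⟩ := proj_surjective B v f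
  induction x using CliffordAlgebra.left_induction with
  | algebraMap r =>
    refine ⟨0, fun j hj => ?_⟩
    have h : proj B v (algebraMap ℂ (Cl B) r) = r • vac B v := by
      rw [vac, ← mul_one (algebraMap ℂ (Cl B) r), ← smul_eq_mul, map_smul, algebraMap_smul]
    rw [h, map_smul, act_vac_of_neg (by simpa using hj), smul_zero]
  | add x y hx hy =>
    obtain ⟨M, hM⟩ := hx
    obtain ⟨N, hN⟩ := hy
    refine ⟨max M N, fun j hj => ?_⟩
    rw [map_add, map_add, hM j (by omega), hN j (by omega), add_zero]
  | ι_mul x m hx =>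
    obtain ⟨M, hM⟩ := hx
    obtain ⟨N, hN⟩ := hform m
    refine ⟨max M N, fun j hj => ?_⟩
    have h := act_act_add_swap hv.isSymm (v j) m (proj B v x)
    rw [hM j (by omega), hN j (by omega), map_zero, zero_smul, add_zero, act_proj (v := v) m] at h
    exact h

/-- On each tensor, only finitely many of the operators `v_j ⊗ v_{-j}` are nonzero. -/
theorem finite_support (hv : IsSplitBasis B v) (t : F B v ⊗[ℂ] F B v) :
    {j : ℤ | TensorProduct.map (act B v (v j)) (act B v (v (-j))) t ≠ 0}.Finite := by
  induction t using TensorProduct.induction_on with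
  | zero => simp
  | tmul f g =>
    obtain ⟨M, hM⟩ := exists_act_eq_zero hv f
    obtain ⟨N, hN⟩ := exists_act_eq_zero hv g
    refine (Set.finite_Icc (-(M : ℤ)) N).subset fun j hj => ?_
    by_contra hc
    apply hj
    rw [Set.mem_Icc, not_and_or] at hc
    rw [TensorProduct.map_tmul]
    rcases hc with hc | hc
    · rw [hM j (by omega), TensorProduct.zero_tmul]
    · rw [hN (-j) (by omega), TensorProduct.tmul_zero]
  | add x y hx hy =>
    refine (hx.union hy).subset fun j hj => ?_
    by_contra hc
    apply hj
    simp only [Set.mem_union, Set.mem_ofPred_eq, not_or, not_not] at hc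
    rw [map_add, hc.1, hc.2, add_zero]

theorem finite_support' (hv : IsSplitBasis B v) (t : F B v ⊗[ℂ] F B v) :
    (Function.support fun j : {j : ℤ // j ≠ 0} =>
      TensorProduct.map (act B v (v j)) (act B v (v (-(j : ℤ)))) t).Finite :=
  (finite_support hv t).preimage Subtype.val_injective.injOn

/-- The operator `S' = ∑_{j ≠ 0} v_j ⊗ v_{-j}` on `F ⊗ F`; on each tensor only finitely many terms
of the sum are nonzero. -/
def S' (hv : IsSplitBasis B v) : F B v ⊗[ℂ] F B v →ₗ[ℂ] F B v ⊗[ℂ] F B v where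
  toFun t := ∑ᶠ j : {j : ℤ // j ≠ 0},
    TensorProduct.map (act B v (v j)) (act B v (v (-(j : ℤ)))) t
  map_add' s t := by
    simp only [map_add]
    exact finsum_add_distrib (finite_support' hv s) (finite_support' hv t)
  map_smul' c t := by
    simp only [map_smul, RingHom.id_apply]
    exact (smul_finsum' c (finite_support' hv t)).symm

/-- The operator `S = v₀ ⊗ v₀ + S'` on `F ⊗ F`. -/
def S (hv : IsSplitBasis B v) : F B v ⊗[ℂ] F B v →ₗ[ℂ] F B v ⊗[ℂ] F B v :=
  TensorProduct.map (act B v (v 0)) (act B v (v 0)) + S' hv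

end Module

end

end SpinModule

/-!
The operator `∑_{i ∈ I} v_i ⊗ v_{-i}` (`casimir`), with `I = ℤ` for `S` and `I = ℤ ∖ {0}` for `S'`,
is the Casimir element of the space `W` spanned by the `v_i` with `i ∈ I`, which is `V` or `V'`.

*The orbits solve the equations.* An element `a` of the Pin group acts on `W` by the isometry
`w ↦ a w a⁻¹`. Since `a` and `a⁻¹` supercommute with `v_j` for `|j|` large, this isometry preserves
a finite-dimensional nondegenerate subspace spanned by `v_i` with `|i| ≤ N`, and on given vectors of
`F` only those `v_i` contribute to the Casimir operator. As the Casimir element of a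
finite-dimensional space is invariant under isometries, the operator commutes with `a ⊗ a`
(`casimir_smul_smul`). The vacuum vectors satisfy the equations by inspection.

*Solutions lie in the orbits.* Let `∑_{i ∈ I} v_i τ ⊗ v_{-i} τ = c τ ⊗ τ` with `τ ≠ 0`, and suppose
that `v_j τ ≠ 0` for some `j < 0`. Since `v_j` is nilpotent, `v_j τ` is not a multiple of `τ`, and a
functional `x` with `x(τ) = 0` and `x(v_j τ) = 1`, applied to the first factor of the equation, shows
that `u = ∑ x(v_i τ) v_{-i}` kills `τ`; here `(u, v_j) = 1`, and `(u, u) = 0` because `u² τ = 0`.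
Hence `n = v_j - u` satisfies `(n, n) = -2` and `n τ = v_j τ`, so `v_j τ` is the image of `τ` under
an element of the Pin group (`exists_vec_smul_eq_act`) and solves the same equation. After finitely
many such steps the result is killed by all `v_j` with `j < 0`, and then it is a multiple of `|0⟩`
(`exists_eq_smul_vac`). So `τ` is a multiple of a product of non-isotropic vectors applied to `|0⟩`.
If their number is odd, it is made even by `v₀`, which multiplies `|0⟩` by a scalar, in the case of
`V`, and by `v₁ + v₋₁`, which maps `|1⟩` to `|0⟩`, in the case of `V'`, where `v₀` detects the parity.
-/

namespace SpinModule

noncomputable section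

variable {V : Type*} [AddCommGroup V] [Module ℂ V]

/-! ### Pin and Spin groups -/

section Groups

variable {B : LinearMap.BilinForm ℂ V}

theorem vec_mul_self (n : V) : vec B n * vec B n = algebraMap ℂ (Cl B) (B n n / 2) := by
  rw [CliffordAlgebra.ι_sq_scalar]
  congr 1
  simp only [smul_apply, LinearMap.BilinMap.toQuadraticMap_apply, smul_eq_mul]
  ring

/-- The units of `Cℓ V` whose conjugation maps the subspace `W` of `V` onto itself. -/
def conjStabilizer (B : LinearMap.BilinForm ℂ V) (W : Submodule ℂ V) : Subgroup (Cl B)ˣ where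
  carrier := {a | (∀ w ∈ W, (a : Cl B) * vec B w * ((a⁻¹ : (Cl B)ˣ) : Cl B) ∈ W.map (vec B)) ∧
    ∀ w ∈ W, ((a⁻¹ : (Cl B)ˣ) : Cl B) * vec B w * (a : Cl B) ∈ W.map (vec B)}
  mul_mem' := by
    rintro a b ⟨ha, ha'⟩ ⟨hb, hb'⟩
    refine ⟨fun w hw => ?_, fun w hw => ?_⟩
    · obtain ⟨w', hw', h⟩ := hb w hw
      have := ha w' hw'
      rw [h] at this
      simpa [mul_assoc] using this
    · obtain ⟨w', hw', h⟩ := ha' w hw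
      have := hb' w' hw'
      rw [h] at this
      simpa [mul_assoc] using this
  one_mem' := by
    refine ⟨fun w hw => ?_, fun w hw => ?_⟩ <;> simpa using ⟨w, hw, rfl⟩
  inv_mem' := by
    rintro a ⟨ha, ha'⟩
    exact ⟨fun w hw => by simpa using ha' w hw, fun w hw => by simpa using ha w hw⟩

/-- A set equality `a V a⁻¹ = V` gives invariance under conjugation by both `a` and `a⁻¹`. -/
theorem conj_mem_range_of_image_eq {a : (Cl B)ˣ}
    (ha : (fun x : Cl B => (a : Cl B) * x * ((a⁻¹ : (Cl B)ˣ) : Cl B)) '' Set.range (vec B)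
      = Set.range (vec B)) (u : V) :
    (∃ u', vec B u' = (a : Cl B) * vec B u * ((a⁻¹ : (Cl B)ˣ) : Cl B)) ∧
      ∃ u', vec B u' = ((a⁻¹ : (Cl B)ˣ) : Cl B) * vec B u * (a : Cl B) := by
  constructor
  · have h : (a : Cl B) * vec B u * ((a⁻¹ : (Cl B)ˣ) : Cl B) ∈ Set.range (vec B) := by
      rw [← ha]
      exact ⟨_, ⟨u, rfl⟩, rfl⟩
    exact h
  · have h : vec B u ∈ Set.range (vec B) := ⟨u, rfl⟩
    rw [← ha] at h
    obtain ⟨_, ⟨u', rfl⟩, h⟩ := h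
    refine ⟨u', ?_⟩
    rw [← h]
    simp [mul_assoc]

theorem pin_le_conjStabilizer : pin B ≤ conjStabilizer B ⊤ := by
  refine (Subgroup.closure_le _).2 fun a ha => ?_
  refine ⟨fun w _ => ?_, fun w _ => ?_⟩
  · obtain ⟨u', h⟩ := (conj_mem_range_of_image_eq ha w).1
    exact ⟨u', trivial, h⟩
  · obtain ⟨u', h⟩ := (conj_mem_range_of_image_eq ha w).2
    exact ⟨u', trivial, h⟩

theorem clIncl_vec (W : Submodule ℂ V) (w : W) :
    clIncl B W (vec (B.restrict W) w) = vec B (w : V) :=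
  CliffordAlgebra.map_apply_ι _ _

theorem pin_restrict_map_le_conjStabilizer (W : Submodule ℂ V) :
    (pin (B.restrict W)).map (Units.map (clIncl B W : Cl (B.restrict W) →* Cl B)) ≤
      conjStabilizer B W := by
  rw [Subgroup.map_le_iff_le_comap]
  refine (Subgroup.closure_le _).2 fun a ha => ?_
  refine ⟨fun w hw => ?_, fun w hw => ?_⟩
  · obtain ⟨u', h⟩ := (conj_mem_range_of_image_eq ha ⟨w, hw⟩).1
    refine ⟨u', u'.2, ?_⟩
    rw [← clIncl_vec, h, map_mul, map_mul, clIncl_vec, ← map_inv]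
    rfl
  · obtain ⟨u', h⟩ := (conj_mem_range_of_image_eq ha ⟨w, hw⟩).2
    refine ⟨u', u'.2, ?_⟩
    rw [← clIncl_vec, h, map_mul, map_mul, clIncl_vec, ← map_inv]
    rfl

/-- Conjugation by a non-isotropic vector `n` is minus the reflection in `n`, so `n ∈ Pin V`. -/
theorem exists_mem_pin_of_vec (hB : B.IsSymm) {n : V} (hn : B n n ≠ 0) :
    ∃ a ∈ pin B, (a : Cl B) = vec B n := by
  have hq : B n n / 2 ≠ 0 := div_ne_zero hn two_ne_zero
  have h1 : vec B n * ((B n n / 2)⁻¹ • vec B n) = 1 := by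
    rw [mul_smul_comm, vec_mul_self, ← algebraMap_smul (Cl B), smul_eq_mul, ← map_mul,
      inv_mul_cancel₀ hq, map_one]
  have h2 : ((B n n / 2)⁻¹ • vec B n) * vec B n = 1 := by
    rw [smul_mul_assoc, vec_mul_self, ← algebraMap_smul (Cl B), smul_eq_mul, ← map_mul,
      inv_mul_cancel₀ hq, map_one]
  have key : ∀ u : V, vec B n * vec B u * ((B n n / 2)⁻¹ • vec B n)
      = vec B ((B n n / 2)⁻¹ • (B n u) • n - u) := by
    intro u
    have h3 : vec B n * vec B u = algebraMap ℂ (Cl B) (B n u) - vec B u * vec B n :=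
      eq_sub_of_add_eq (vec_mul_vec_add_swap B hB n u)
    rw [h3, sub_mul, mul_assoc, h1, mul_one, map_sub, map_smul, map_smul, mul_smul_comm,
      Algebra.smul_def (B n u)]
  refine ⟨⟨vec B n, (B n n / 2)⁻¹ • vec B n, h1, h2⟩, Subgroup.subset_closure ?_, rfl⟩
  have hsub : ∀ u, vec B n * vec B u * ((B n n / 2)⁻¹ • vec B n) ∈ Set.range (vec B) :=
    fun u => ⟨_, (key u).symm⟩
  refine Set.Subset.antisymm ?_ ?_
  · rintro _ ⟨_, ⟨u, rfl⟩, rfl⟩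
    exact hsub u
  · rintro _ ⟨u, rfl⟩
    refine ⟨_, hsub u, ?_⟩
    -- conjugation by `n` is an involution, `n²` being a scalar
    change vec B n * (vec B n * vec B u * ((B n n / 2)⁻¹ • vec B n)) *
      ((B n n / 2)⁻¹ • vec B n) = vec B u
    simp only [mul_smul_comm, smul_mul_assoc, mul_assoc, vec_mul_self]
    simp only [← mul_assoc, vec_mul_self]
    rw [← Algebra.commutes, ← mul_assoc, ← map_mul, ← Algebra.smul_def, smul_smul, smul_smul]
    convert one_smul ℂ (vec B u) using 2
    field_simp

/-- A nonzero scalar multiple of a product of evenly many non-isotropic vectors is in `Spin V`. -/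
theorem exists_mem_spin_of_list (hB : B.IsSymm) {l : List V} (hl : ∀ n ∈ l, B n n ≠ 0)
    (hlen : Even l.length) {c : ℂ} (hc : c ≠ 0) :
    ∃ a ∈ spin B, (a : Cl B) = c • (l.map (vec B)).prod := by
  have hpin : ∃ a ∈ pin B, (a : Cl B) = (l.map (vec B)).prod := by
    clear hlen
    induction l with
    | nil => exact ⟨1, one_mem _, by simp⟩
    | cons n l ih =>
      obtain ⟨a, ha, ha'⟩ := ih fun m hm => hl m (List.mem_cons_of_mem _ hm)
      obtain ⟨b, hb, hb'⟩ := exists_mem_pin_of_vec hB (hl n List.mem_cons_self)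
      exact ⟨b * a, mul_mem hb ha, by simp [ha', hb']⟩
  have hdeg : (l.map (vec B)).prod ∈ CliffordAlgebra.evenOdd (halfForm B) (l.length : ZMod 2) := by
    clear hlen hpin hl
    induction l with
    | nil => simpa using SetLike.GradedOne.one_mem (A := CliffordAlgebra.evenOdd (halfForm B))
    | cons n l ih =>
      rw [List.map_cons, List.prod_cons, List.length_cons, Nat.cast_succ, add_comm]
      exact SetLike.mul_mem_graded (CliffordAlgebra.ι_mem_evenOdd_one _ n) ih
  obtain ⟨a, ha, ha'⟩ := hpin
  let s : (Cl B)ˣ := Units.map (algebraMap ℂ (Cl B) : ℂ →* Cl B) (Units.mk0 c hc)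
  have hs : (s : Cl B) = algebraMap ℂ (Cl B) c := rfl
  have hcomm : ∀ x : Cl B, (s : Cl B) * x * ((s⁻¹ : (Cl B)ˣ) : Cl B) = x := by
    intro x
    rw [hs, Algebra.commutes, ← hs, mul_assoc, Units.mul_inv, mul_one]
  have hspin : s ∈ pin B := by
    refine Subgroup.subset_closure ?_
    change _ '' _ = _
    simp only [hcomm, Set.image_id']
  refine ⟨s * a, ⟨mul_mem hspin ha, ?_⟩, by rw [Units.val_mul, ha', hs, Algebra.smul_def]⟩
  rw [Units.val_mul, ha', hs, ← Algebra.smul_def]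
  have h0 : (l.length : ZMod 2) = 0 := (ZMod.natCast_eq_zero_iff_even).2 hlen
  rw [h0] at hdeg
  exact Subalgebra.smul_mem _ hdeg c

theorem isSymm_restrict (hB : B.IsSymm) (W : Submodule ℂ V) : (B.restrict W).IsSymm :=
  ⟨fun x y => hB.eq x y⟩

theorem exists_mem_spinSub_of_list (hB : B.IsSymm) (W : Submodule ℂ V) {l : List V}
    (hl : ∀ n ∈ l, n ∈ W ∧ B n n ≠ 0) (hlen : Even l.length) {c : ℂ} (hc : c ≠ 0) :
    ∃ a ∈ spinSub B W, (a : Cl B) = c • (l.map (vec B)).prod := by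
  lift l to List W using fun n hn => (hl n hn).1
  obtain ⟨a, ha, ha'⟩ := exists_mem_spin_of_list (isSymm_restrict hB W) (l := l)
    (fun n hn => (hl n (List.mem_map_of_mem hn)).2) (by simpa using hlen) hc
  refine ⟨_, ⟨a, ha, rfl⟩, ?_⟩
  change clIncl B W (a : Cl (B.restrict W)) = _
  rw [ha', map_smul, map_list_prod, List.map_map, List.map_map]
  congr 3
  funext w
  exact clIncl_vec W w

/-- Every element of `Cℓ V` supercommutes with `v_j` for `|j|` large. -/
theorem exists_mul_vec_eq {v : Module.Basis ℤ ℂ V} (hv : IsSplitBasis B v) (x : Cl B) :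
    ∃ N : ℕ, ∀ j : ℤ, N < j.natAbs →
      x * vec B (v j) = vec B (v j) * CliffordAlgebra.involute x := by
  have hform : ∀ m : V, ∃ N : ℕ, ∀ j : ℤ, N < j.natAbs → B m (v j) = 0 := by
    intro m
    induction v.mem_span m using Submodule.span_induction with
    | zero => exact ⟨0, fun j _ => by simp⟩
    | mem x hx =>
      obtain ⟨i, rfl⟩ := hx
      exact ⟨i.natAbs, fun j hj => by rw [hv, if_neg (by omega)]⟩
    | add x y _ _ hx hy =>
      obtain ⟨M, hM⟩ := hx
      obtain ⟨N, hN⟩ := hy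
      exact ⟨max M N, fun j hj => by
        rw [map_add, LinearMap.add_apply, hM j (by omega), hN j (by omega), add_zero]⟩
    | smul c x _ hx =>
      obtain ⟨M, hM⟩ := hx
      exact ⟨M, fun j hj => by rw [map_smul, LinearMap.smul_apply, hM j hj, smul_zero]⟩
  induction x using CliffordAlgebra.induction with
  | algebraMap r => exact ⟨0, fun j _ => by rw [AlgHom.commutes, Algebra.commutes]⟩
  | ι m =>
    obtain ⟨N, hN⟩ := hform m
    refine ⟨N, fun j hj => ?_⟩
    have h := vec_mul_vec_add_swap B hv.isSymm m (v j)
    rw [hN j hj, map_zero] at h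
    rw [CliffordAlgebra.involute_ι, mul_neg]
    exact eq_neg_of_add_eq_zero_left h
  | mul x y hx hy =>
    obtain ⟨M, hM⟩ := hx
    obtain ⟨N, hN⟩ := hy
    refine ⟨max M N, fun j hj => ?_⟩
    rw [map_mul, mul_assoc, hN j (by omega), ← mul_assoc, hM j (by omega), mul_assoc]
  | add x y hx hy =>
    obtain ⟨M, hM⟩ := hx
    obtain ⟨N, hN⟩ := hy
    refine ⟨max M N, fun j hj => ?_⟩
    rw [map_add, add_mul, mul_add, hM j (by omega), hN j (by omega)]

end Groups

/-! ### Expansion in the split basis -/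

section Basis

variable {B : LinearMap.BilinForm ℂ V} {v : Module.Basis ℤ ℂ V}

theorem IsSplitBasis.apply_eq_repr (hv : IsSplitBasis B v) (w : V) (k : ℤ) :
    B w (v k) = v.repr w (-k) := by
  have h : B.flip (v k) = v.coord (-k) := v.ext fun i => by
    rw [LinearMap.BilinForm.flip_apply, hv, v.coord_apply, v.repr_self, Finsupp.single_apply]
  have h' := LinearMap.congr_fun h w
  rwa [LinearMap.BilinForm.flip_apply] at h'

theorem IsSplitBasis.eq_sum (hv : IsSplitBasis B v) {w : V} {s : Finset ℤ}
    (hw : ∀ k ∉ s, B w (v k) = 0) : w = ∑ k ∈ s, B w (v k) • v (-k) := by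
  refine v.ext_elem fun i => ?_
  obtain ⟨m, rfl⟩ : ∃ m, i = -m := ⟨-i, (neg_neg i).symm⟩
  rw [← hv.apply_eq_repr, ← hv.apply_eq_repr, map_sum, LinearMap.sum_apply]
  simp only [map_smul, LinearMap.smul_apply, hv _ _, neg_inj, smul_eq_mul, mul_ite, mul_one,
    mul_zero, Finset.sum_ite_eq']
  split_ifs with h
  · rfl
  · exact hw m h

end Basis

/-! ### The Casimir pairing -/

section Casimir

/-- The value at `f ⊗ g` of the operator `∑_{i ∈ I} v_i ⊗ v_{-i}`: for `I = ℤ` this is `S`, and for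
`I = ℤ ∖ {0}` it is `S'`. Only finitely many terms are nonzero, as `v_i f = 0` for `i ≪ 0` and
`v_{-i} g = 0` for `i ≫ 0`. -/
def casimir (B : LinearMap.BilinForm ℂ V) (v : Module.Basis ℤ ℂ V) (I : Set ℤ) (f g : F B v) :
    F B v ⊗[ℂ] F B v :=
  ∑ᶠ i ∈ I, act B v (v i) f ⊗ₜ[ℂ] act B v (v (-i)) g

variable {B : LinearMap.BilinForm ℂ V} {v : Module.Basis ℤ ℂ V}

/-- The indices `i ∈ I` with `|i| ≤ N`. -/
def window (I : Set ℤ) (N : ℕ) : Finset ℤ :=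
  ((Set.finite_Icc (-(N : ℤ)) N).inter_of_left I).toFinset

theorem mem_window {I : Set ℤ} {N : ℕ} {i : ℤ} : i ∈ window I N ↔ i.natAbs ≤ N ∧ i ∈ I := by
  rw [window, Set.Finite.mem_toFinset, Set.mem_inter_iff, Set.mem_Icc]
  exact and_congr_left' (by omega)

theorem casimir_eq_sum (I : Set ℤ) {f g : F B v} {N : ℕ}
    (hf : ∀ j : ℤ, j < -(N : ℤ) → act B v (v j) f = 0)
    (hg : ∀ j : ℤ, j < -(N : ℤ) → act B v (v j) g = 0) :
    casimir B v I f g = ∑ i ∈ window I N, act B v (v i) f ⊗ₜ[ℂ] act B v (v (-i)) g := by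
  refine finsum_mem_eq_sum_of_inter_support_eq _ (Set.ext fun i => ?_)
  simp only [Set.mem_inter_iff, Function.mem_support, Finset.mem_coe, mem_window]
  refine and_congr_left fun h => ⟨fun hi => ⟨?_, hi⟩, And.right⟩
  by_contra hc
  apply h
  rcases lt_or_ge i 0 with h0 | h0
  · rw [hf i (by omega), TensorProduct.zero_tmul]
  · rw [hg (-i) (by omega), TensorProduct.tmul_zero]

theorem S'_tmul (hv : IsSplitBasis B v) (f g : F B v) :
    S' hv (f ⊗ₜ[ℂ] g) = casimir B v {0}ᶜ f g :=
  finsum_set_coe_eq_finsum_mem (f := fun i : ℤ => act B v (v i) f ⊗ₜ[ℂ] act B v (v (-i)) g) {0}ᶜ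

theorem S_tmul (hv : IsSplitBasis B v) (f g : F B v) :
    S hv (f ⊗ₜ[ℂ] g) = casimir B v Set.univ f g := by
  obtain ⟨M, hM⟩ := exists_act_eq_zero hv f
  obtain ⟨N, hN⟩ := exists_act_eq_zero hv g
  have hf : ∀ j : ℤ, j < -((max M N : ℕ) : ℤ) → act B v (v j) f = 0 := fun j hj => hM j (by omega)
  have hg : ∀ j : ℤ, j < -((max M N : ℕ) : ℤ) → act B v (v j) g = 0 := fun j hj => hN j (by omega)
  have hw : window Set.univ (max M N) = insert 0 (window {0}ᶜ (max M N)) := by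
    ext i
    simp only [Finset.mem_insert, mem_window, Set.mem_univ, Set.mem_compl_iff,
      Set.mem_singleton_iff, and_true]
    omega
  rw [S, LinearMap.add_apply, S'_tmul, casimir_eq_sum _ hf hg, casimir_eq_sum _ hf hg, hw,
    Finset.sum_insert (by simp [mem_window]), TensorProduct.map_tmul, neg_zero]

/-- `∑_{i ∈ I} v_i ⊗ v_{-i}` commutes with `a ⊗ a` if conjugation by `a` preserves the space `W`
spanned by the `v_i` with `i ∈ I`: that conjugation is an isometry of a finite-dimensional
nondegenerate piece of `W`, whose Casimir element the sum is. -/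
theorem casimir_smul_smul (hv : IsSplitBasis B v) {I : Set ℤ} (hI : ∀ i ∈ I, -i ∈ I)
    {W : Submodule ℂ V} (hW : ∀ w, w ∈ W ↔ ∀ k ∉ I, B w (v k) = 0) {a : (Cl B)ˣ}
    (ha : a ∈ conjStabilizer B W) (f g : F B v) :
    casimir B v I ((a : Cl B) • f) ((a : Cl B) • g) =
      TensorProduct.map (Algebra.lsmul ℂ ℂ (F B v) (a : Cl B))
        (Algebra.lsmul ℂ ℂ (F B v) (a : Cl B)) (casimir B v I f g) := by
  obtain ⟨N₁, h₁⟩ := exists_act_eq_zero hv f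
  obtain ⟨N₂, h₂⟩ := exists_act_eq_zero hv g
  obtain ⟨N₃, h₃⟩ := exists_act_eq_zero hv ((a : Cl B) • f)
  obtain ⟨N₄, h₄⟩ := exists_act_eq_zero hv ((a : Cl B) • g)
  obtain ⟨N₅, h₅⟩ := exists_mul_vec_eq hv (a : Cl B)
  obtain ⟨N₆, h₆⟩ := exists_mul_vec_eq hv ((a⁻¹ : (Cl B)ˣ) : Cl B)
  set N := N₁ + N₂ + N₃ + N₄ + N₅ + N₆ with hN
  rw [casimir_eq_sum I (N := N) (fun j hj => h₃ j (by omega)) (fun j hj => h₄ j (by omega)),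
    casimir_eq_sum I (N := N) (fun j hj => h₁ j (by omega)) (fun j hj => h₂ j (by omega))]
  have hwin : ∀ i ∈ window I N, -i ∈ window I N := fun i hi => by
    rw [mem_window] at hi ⊢
    exact ⟨by omega, hI i hi.2⟩
  have hmemW : ∀ i ∈ I, v i ∈ W := fun i hi => (hW _).2 fun k hk => by
    rw [hv, if_neg]
    rintro rfl
    exact hk (by simpa using hI _ hi)
  -- conjugates of the `v_i` with `|i| ≤ N` pair to zero with the `v_j` with `|j| > N`
  have hfar : ∀ b : (Cl B)ˣ, (∀ j : ℤ, N < j.natAbs →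
        (b : Cl B) * vec B (v j) = vec B (v j) * CliffordAlgebra.involute (b : Cl B)) →
      (∀ j : ℤ, N < j.natAbs → ((b⁻¹ : (Cl B)ˣ) : Cl B) * vec B (v j) =
        vec B (v j) * CliffordAlgebra.involute ((b⁻¹ : (Cl B)ˣ) : Cl B)) →
      ∀ i : ℤ, i ∈ window I N → ∀ w ∈ W,
        vec B w = (b : Cl B) * vec B (v i) * ((b⁻¹ : (Cl B)ˣ) : Cl B) →
        ∀ k ∉ window I N, B w (v k) = 0 := by
    intro b hb hb' i hi w hw hbw k hk
    by_cases hkI : k ∈ I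
    · have hkN : N < k.natAbs := by
        by_contra hc
        exact hk (mem_window.2 ⟨by omega, hkI⟩)
      have hik : vec B (v i) * vec B (v k) =
          vec B (v k) * CliffordAlgebra.involute (vec B (v i)) := by
        have h := vec_mul_vec_add_swap B hv.isSymm (v i) (v k)
        rw [hv, if_neg (by rintro rfl; have := (mem_window.1 hi).1; omega), map_zero] at h
        rw [CliffordAlgebra.involute_ι, mul_neg]
        exact eq_neg_of_add_eq_zero_left h
      have hwk : vec B w * vec B (v k) = vec B (v k) * CliffordAlgebra.involute (vec B w) := by
        rw [hbw, mul_assoc, hb' k hkN, mul_assoc, ← mul_assoc (vec B (v i)), hik, ← mul_assoc,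
          ← mul_assoc, hb k hkN, map_mul, map_mul]
        simp only [mul_assoc]
      rw [CliffordAlgebra.involute_ι, mul_neg] at hwk
      have h := vec_mul_vec_add_swap B hv.isSymm w (v k)
      rw [hwk, neg_add_cancel] at h
      exact (FaithfulSMul.algebraMap_injective ℂ (Cl B)) (by rw [← h, map_zero])
    · exact (hW w).1 hw k hkI
  have hT : ∀ i, ∃ w, i ∈ window I N → (vec B w =
      (a : Cl B) * vec B (v i) * ((a⁻¹ : (Cl B)ˣ) : Cl B) ∧ ∀ k ∉ window I N, B w (v k) = 0) := by
    intro i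
    by_cases hi : i ∈ window I N
    · obtain ⟨w, hw, h⟩ := ha.1 (v i) (hmemW i (mem_window.1 hi).2)
      exact ⟨w, fun _ => ⟨h, hfar a (fun j hj => h₅ j (by omega)) (fun j hj => h₆ j (by omega))
        i hi w hw h⟩⟩
    · exact ⟨0, fun h => absurd h hi⟩
  have hR : ∀ i, ∃ w, i ∈ window I N → (vec B w =
      ((a⁻¹ : (Cl B)ˣ) : Cl B) * vec B (v i) * (a : Cl B) ∧
        ∀ k ∉ window I N, B w (v k) = 0) := by
    intro i
    by_cases hi : i ∈ window I N
    · obtain ⟨w, hw, h⟩ := ha.2 (v i) (hmemW i (mem_window.1 hi).2)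
      exact ⟨w, fun _ => ⟨h, hfar a⁻¹ (fun j hj => h₆ j (by omega))
        (fun j hj => by simpa using h₅ j (by omega)) i hi w hw (by simpa using h)⟩⟩
    · exact ⟨0, fun h => absurd h hi⟩
  choose T hT using hT
  choose R hR using hR
  -- `R` and `T` are adjoint, being inverse isometries
  have hadj : ∀ i ∈ window I N, ∀ k ∈ window I N, B (R i) (v k) = B (v i) (T k) := by
    intro i hi k hk
    apply FaithfulSMul.algebraMap_injective ℂ (Cl B)
    rw [← vec_mul_vec_add_swap B hv.isSymm, (hR i hi).1]
    have h : algebraMap ℂ (Cl B) (B (v i) (T k)) =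
        ((a⁻¹ : (Cl B)ˣ) : Cl B) * algebraMap ℂ (Cl B) (B (v i) (T k)) * (a : Cl B) := by
      rw [← Algebra.commutes, mul_assoc, Units.inv_mul, mul_one]
    rw [h, ← vec_mul_vec_add_swap B hv.isSymm, (hT k hk).1]
    simp only [mul_add, add_mul, mul_assoc, Units.inv_mul, Units.inv_mul_cancel_left, mul_one]
  have hact : ∀ i ∈ window I N, ∀ h : F B v,
      act B v (v i) ((a : Cl B) • h) = (a : Cl B) • act B v (R i) h := by
    intro i hi h
    simp only [act, Algebra.lsmul_coe]
    rw [(hR i hi).1, smul_smul, smul_smul]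
    congr 1
    simp only [mul_assoc, Units.mul_inv_cancel_left]
  have hsum : ∀ k ∈ window I N, ∑ i ∈ window I N, B (v (-i)) (T k) • act B v (R i) f =
      act B v (v k) f := by
    intro k hk
    have hexp : T k = ∑ i ∈ window I N, B (v (-i)) (T k) • v i := by
      have h := hv.eq_sum (hT k hk).2
      rw [Finset.sum_nbij (fun i => -i) hwin (fun _ _ _ _ h => neg_injective h)
        (fun i hi => ⟨-i, hwin i hi, neg_neg i⟩) (g := fun i => B (v (-i)) (T k) • v i)] at h
      · exact h
      · intro i _
        rw [neg_neg, ← hv.isSymm.eq]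
    have hvec : ∑ i ∈ window I N, B (v (-i)) (T k) • vec B (R i) = vec B (v k) := by
      have h := congrArg (vec B) hexp
      rw [map_sum] at h
      simp only [map_smul] at h
      have h' : vec B (v k) = ((a⁻¹ : (Cl B)ˣ) : Cl B) * vec B (T k) * (a : Cl B) := by
        rw [(hT k hk).1]
        simp [mul_assoc]
      rw [h', h, Finset.mul_sum, Finset.sum_mul]
      refine Finset.sum_congr rfl fun i hi => ?_
      rw [(hR i hi).1, mul_smul_comm, smul_mul_assoc]
    simp only [act, Algebra.lsmul_coe]
    rw [← hvec, Finset.sum_smul]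
    simp only [smul_assoc]
  have hRneg : ∀ i ∈ window I N, act B v (R (-i)) g =
      ∑ k ∈ window I N, B (v (-i)) (T k) • act B v (v (-k)) g := by
    intro i hi
    have h := hv.eq_sum (hR (-i) (hwin i hi)).2
    rw [Finset.sum_congr rfl fun k hk => by rw [hadj (-i) (hwin i hi) k hk]] at h
    conv_lhs => rw [h]
    simp only [act, map_sum, map_smul, LinearMap.sum_apply, LinearMap.smul_apply]
  have main : ∑ i ∈ window I N, act B v (R i) f ⊗ₜ[ℂ] act B v (R (-i)) g =
      ∑ k ∈ window I N, act B v (v k) f ⊗ₜ[ℂ] act B v (v (-k)) g := by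
    rw [Finset.sum_congr rfl fun i hi => by rw [hRneg i hi, TensorProduct.tmul_sum],
      Finset.sum_comm]
    refine Finset.sum_congr rfl fun k hk => ?_
    rw [← hsum k hk, TensorProduct.sum_tmul]
    refine Finset.sum_congr rfl fun i _ => ?_
    rw [TensorProduct.tmul_smul, TensorProduct.smul_tmul']
  rw [← main, map_sum]
  refine Finset.sum_congr rfl fun i hi => ?_
  rw [hact i hi, hact (-i) (hwin i hi), TensorProduct.map_tmul]
  rfl

/-- The equation `∑_{i ∈ I} v_i τ ⊗ v_{-i} τ = c τ ⊗ τ` is invariant under the stabilizer of `W`. -/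
theorem casimir_self_smul (hv : IsSplitBasis B v) {I : Set ℤ} (hI : ∀ i ∈ I, -i ∈ I)
    {W : Submodule ℂ V} (hW : ∀ w, w ∈ W ↔ ∀ k ∉ I, B w (v k) = 0) {a : (Cl B)ˣ}
    (ha : a ∈ conjStabilizer B W) {c : ℂ} {τ : F B v}
    (hτ : casimir B v I τ τ = c • (τ ⊗ₜ[ℂ] τ)) :
    casimir B v I ((a : Cl B) • τ) ((a : Cl B) • τ) =
      c • (((a : Cl B) • τ) ⊗ₜ[ℂ] ((a : Cl B) • τ)) := by
  rw [casimir_smul_smul hv hI hW ha, hτ, map_smul, TensorProduct.map_tmul]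
  rfl

end Casimir

/-! ### Vectors annihilated by all `v_j` with `j < 0` -/

section Vacuum

variable {B : LinearMap.BilinForm ℂ V} {v : Module.Basis ℤ ℂ V}

theorem act_act_self_of_ne_zero (hv : IsSplitBasis B v) {j : ℤ} (hj : j ≠ 0) (f : F B v) :
    act B v (v j) (act B v (v j) f) = 0 := by
  have h := act_act_add_swap hv.isSymm (v j) (v j) f
  rw [hv, if_neg (by omega), zero_smul, ← two_smul ℂ] at h
  exact (smul_eq_zero.1 h).resolve_left two_ne_zero

theorem act_act_eq_neg (hv : IsSplitBasis B v) {i j : ℤ} (hij : i ≠ -j) (f : F B v) :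
    act B v (v i) (act B v (v j) f) = -act B v (v j) (act B v (v i) f) := by
  have h := act_act_add_swap hv.isSymm (v i) (v j) f
  rw [hv, if_neg hij, zero_smul] at h
  exact eq_neg_of_add_eq_zero_left h

theorem sqrt_two_sq : (Real.sqrt 2 : ℂ) * (Real.sqrt 2 : ℂ) = 2 := by
  rw [← Complex.ofReal_mul, Real.mul_self_sqrt zero_le_two]
  norm_num

theorem sqrt_two_smul_act_zero_vac :
    (Real.sqrt 2 : ℂ) • act B v (v 0) (vac B v) = -vac B v := by
  rw [eq_neg_iff_add_eq_zero, add_comm, vac, act_proj, mul_one, ← algebraMap_smul (Cl B),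
    ← map_smul, ← map_add, proj_eq_zero_iff, algebraMap_smul]
  exact Submodule.subset_span (Submodule.mem_sup_right (Submodule.mem_span_singleton_self _))

theorem act_zero_vac : act B v (v 0) (vac B v) = -((Real.sqrt 2 : ℂ) / 2) • vac B v := by
  have h := congrArg (fun x => ((Real.sqrt 2 : ℂ) / 2) • x)
    (sqrt_two_smul_act_zero_vac (v := v) (B := B))
  simp only [smul_smul] at h
  rw [div_mul_eq_mul_div, sqrt_two_sq, div_self two_ne_zero, one_smul] at h
  rw [h, smul_neg, neg_smul]

/-- The subspace of `F` spanned by the products of some of `v_1, …, v_N` applied to `|0⟩`. -/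
def level (B : LinearMap.BilinForm ℂ V) (v : Module.Basis ℤ ℂ V) : ℕ → Submodule ℂ (F B v)
  | 0 => Submodule.span ℂ {vac B v}
  | N + 1 => level B v N ⊔ (level B v N).map (act B v (v ((N : ℤ) + 1)))

theorem mem_level_succ {N : ℕ} {f : F B v} : f ∈ level B v (N + 1) ↔
    ∃ a ∈ level B v N, ∃ b ∈ level B v N, f = a + act B v (v ((N : ℤ) + 1)) b := by
  rw [level, Submodule.mem_sup]
  constructor
  · rintro ⟨a, ha, _, ⟨b, hb, rfl⟩, rfl⟩
    exact ⟨a, ha, b, hb, rfl⟩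
  · rintro ⟨a, ha, b, hb, rfl⟩
    exact ⟨a, ha, _, ⟨b, hb, rfl⟩, rfl⟩

theorem level_mono : Monotone (level B v) :=
  monotone_nat_of_le_succ fun _ => le_sup_left

theorem act_eq_zero_of_mem_level (hv : IsSplitBasis B v) {N : ℕ} {f : F B v}
    (hf : f ∈ level B v N) {j : ℤ} (hj : j < -(N : ℤ)) : act B v (v j) f = 0 := by
  induction N generalizing f with
  | zero =>
    obtain ⟨c, rfl⟩ := Submodule.mem_span_singleton.1 hf
    rw [map_smul, act_vac_of_neg (by simpa using hj), smul_zero]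
  | succ N ih =>
    obtain ⟨a, ha, b, hb, rfl⟩ := mem_level_succ.1 hf
    rw [map_add, ih ha (by omega), zero_add, act_act_eq_neg hv (by omega), ih hb (by omega),
      map_zero, neg_zero]

theorem act_mem_level (hv : IsSplitBasis B v) {N : ℕ} {f : F B v} (hf : f ∈ level B v N) {j : ℤ}
    (hj : j.natAbs ≤ N) : act B v (v j) f ∈ level B v N := by
  induction N generalizing f j with
  | zero =>
    obtain ⟨c, rfl⟩ := Submodule.mem_span_singleton.1 hf
    obtain rfl : j = 0 := by omega
    rw [map_smul, act_zero_vac]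
    exact Submodule.smul_mem _ _ (Submodule.smul_mem _ _ (Submodule.mem_span_singleton_self _))
  | succ N ih =>
    obtain ⟨a, ha, b, hb, rfl⟩ := mem_level_succ.1 hf
    rw [map_add]
    rcases (by omega : j.natAbs ≤ N ∨ j = (N : ℤ) + 1 ∨ j = -((N : ℤ) + 1)) with h | rfl | rfl
    · rw [act_act_eq_neg hv (by omega)]
      exact mem_level_succ.2 ⟨_, ih ha h, _, neg_mem (ih hb h), by rw [map_neg]⟩
    · rw [act_act_self_of_ne_zero hv (by omega)]
      exact mem_level_succ.2 ⟨0, zero_mem _, a, ha, add_comm _ _⟩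
    · have h := act_act_add_swap hv.isSymm (v (-((N : ℤ) + 1))) (v ((N : ℤ) + 1)) b
      rw [hv, if_pos rfl, one_smul, act_eq_zero_of_mem_level hv hb (j := -((N : ℤ) + 1)) (by omega),
        map_zero, add_zero] at h
      rw [h, act_eq_zero_of_mem_level hv ha (by omega), zero_add]
      exact level_mono (Nat.le_succ N) hb

theorem exists_mem_level (hv : IsSplitBasis B v) (f : F B v) : ∃ N, f ∈ level B v N := by
  obtain ⟨x, rfl⟩ := proj_surjective B v f
  induction x using CliffordAlgebra.left_induction with
  | algebraMap r =>
    refine ⟨0, Submodule.mem_span_singleton.2 ⟨r, ?_⟩⟩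
    rw [vac, ← algebraMap_smul (Cl B), ← map_smul, smul_eq_mul, mul_one]
  | add x y hx hy =>
    obtain ⟨M, hM⟩ := hx
    obtain ⟨N, hN⟩ := hy
    refine ⟨max M N, ?_⟩
    rw [map_add]
    exact add_mem (level_mono (le_max_left M N) hM) (level_mono (le_max_right M N) hN)
  | ι_mul x m hx =>
    obtain ⟨M, hM⟩ := hx
    rw [← act_proj]
    induction v.mem_span m using Submodule.span_induction with
    | zero => exact ⟨0, by simp [act]⟩
    | mem m hm =>
      obtain ⟨i, rfl⟩ := hm
      exact ⟨max M i.natAbs, act_mem_level hv (level_mono (le_max_left _ _) hM)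
        (le_max_right _ _)⟩
    | add m n _ _ hm hn =>
      obtain ⟨K, hK⟩ := hm
      obtain ⟨N, hN⟩ := hn
      refine ⟨max K N, ?_⟩
      rw [act, map_add, map_add, LinearMap.add_apply]
      exact add_mem (level_mono (le_max_left K N) hK) (level_mono (le_max_right K N) hN)
    | smul c m _ hm =>
      obtain ⟨K, hK⟩ := hm
      refine ⟨K, ?_⟩
      rw [act, map_smul, map_smul, LinearMap.smul_apply]
      exact Submodule.smul_mem _ _ hK

/-- A vector of `F` killed by all `v_j` with `j < 0` is a multiple of `|0⟩`. -/
theorem exists_eq_smul_vac (hv : IsSplitBasis B v) {f : F B v}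
    (hf : ∀ j < 0, act B v (v j) f = 0) : ∃ c : ℂ, f = c • vac B v := by
  obtain ⟨N, hN⟩ := exists_mem_level hv f
  induction N generalizing f with
  | zero =>
    obtain ⟨c, h⟩ := Submodule.mem_span_singleton.1 hN
    exact ⟨c, h.symm⟩
  | succ N ih =>
    obtain ⟨a, ha, b, hb, rfl⟩ := mem_level_succ.1 hN
    have h0 := hf (-((N : ℤ) + 1)) (by omega)
    have h := act_act_add_swap hv.isSymm (v (-((N : ℤ) + 1))) (v ((N : ℤ) + 1)) b
    rw [hv, if_pos rfl, one_smul, act_eq_zero_of_mem_level hv hb (j := -((N : ℤ) + 1)) (by omega),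
        map_zero, add_zero] at h
    rw [map_add, h, act_eq_zero_of_mem_level hv ha (by omega), zero_add] at h0
    subst h0
    rw [map_zero, add_zero] at hf ⊢
    exact ih hf ha

end Vacuum

/-! ### From the quadratic equations to the orbit -/

section Orbit

variable {B : LinearMap.BilinForm ℂ V} {v : Module.Basis ℤ ℂ V}

/-- If `v_j τ ≠ 0` for some `j ≠ 0`, then the equation on `τ ⊗ τ` makes `v_j τ` the image of `τ`
under a non-isotropic vector `n` of `W`: contracting the equation with a functional gives a `u` in
the annihilator of `τ` with `(u, v_j) = 1`, and `n = v_j - u` does. -/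
theorem exists_vec_smul_eq_act (hv : IsSplitBasis B v) {I : Set ℤ} (hI : ∀ i ∈ I, -i ∈ I)
    {W : Submodule ℂ V} (hW : ∀ w, w ∈ W ↔ ∀ k ∉ I, B w (v k) = 0) {c : ℂ} {τ : F B v}
    (hτ : casimir B v I τ τ = c • (τ ⊗ₜ[ℂ] τ)) {j : ℤ} (hj : j ∈ I) (hj0 : j ≠ 0)
    (hjτ : act B v (v j) τ ≠ 0) :
    ∃ n ∈ W, B n n = -2 ∧ act B v n τ = act B v (v j) τ := by
  have hmemW : ∀ i ∈ I, v i ∈ W := fun i hi => (hW _).2 fun k hk => by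
    rw [hv, if_neg]
    rintro rfl
    exact hk (by simpa using hI _ hi)
  have hτ0 : τ ≠ 0 := by
    rintro rfl
    exact hjτ (map_zero _)
  -- `v_j τ` is not a multiple of `τ`, since `v_j` is nilpotent
  have hspan : act B v (v j) τ ∉ Submodule.span ℂ {τ} := by
    intro h
    obtain ⟨d, hd⟩ := Submodule.mem_span_singleton.1 h
    have h2 := act_act_self_of_ne_zero hv hj0 τ
    rw [← hd, map_smul, ← hd, smul_smul] at h2
    have hd0 : d = 0 := by simpa using (smul_eq_zero.1 h2).resolve_right hτ0
    rw [← hd, hd0, zero_smul] at hjτ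
    exact hjτ rfl
  obtain ⟨x, hx, hxτ⟩ := Submodule.exists_le_ker_of_notMem hspan
  replace hxτ : x τ = 0 := hxτ (Submodule.mem_span_singleton_self τ)
  obtain ⟨M, hM⟩ := exists_act_eq_zero hv τ
  set N := M + j.natAbs with hN
  have hwin : ∀ i ∈ window I N, -i ∈ window I N := fun i hi => by
    rw [mem_window] at hi ⊢
    exact ⟨by omega, hI i hi.2⟩
  have hjN : j ∈ window I N := mem_window.2 ⟨by omega, hj⟩
  rw [casimir_eq_sum I (N := N) (fun i hi => hM i (by omega)) (fun i hi => hM i (by omega))] at hτ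
  set d := x (act B v (v j) τ) with hd
  let u : V := d⁻¹ • ∑ i ∈ window I N, x (act B v (v i) τ) • v (-i)
  have huW : u ∈ W := Submodule.smul_mem _ _ (Submodule.sum_mem _ fun i hi =>
    Submodule.smul_mem _ _ (hmemW _ (hI i (mem_window.1 hi).2)))
  have huτ : act B v u τ = 0 := by
    have h := congrArg (fun t => TensorProduct.lid ℂ (F B v)
      (TensorProduct.map x LinearMap.id t)) hτ
    simp only [map_sum, TensorProduct.map_tmul, map_smul, LinearMap.id_apply,
      TensorProduct.lid_tmul, hxτ, zero_smul, smul_zero] at h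
    simp only [u, act, map_sum, map_smul, LinearMap.smul_apply, LinearMap.sum_apply] at h ⊢
    rw [h, smul_zero]
  have huj : B u (v j) = 1 := by
    simp only [u, map_smul, map_sum, LinearMap.smul_apply, LinearMap.sum_apply, hv _ _, neg_inj,
      smul_eq_mul, mul_ite, mul_one, mul_zero, Finset.sum_ite_eq', if_pos hjN]
    exact inv_mul_cancel₀ hx
  have huu : B u u = 0 := by
    have h := act_act_add_swap hv.isSymm u u τ
    rw [huτ, map_zero, add_zero] at h
    exact (smul_eq_zero.1 h.symm).resolve_right hτ0
  refine ⟨v j - u, sub_mem (hmemW j hj) huW, ?_, ?_⟩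
  · have hju : B (v j) u = 1 := by rw [← huj, ← hv.isSymm.eq]
    have hjj : B (v j) (v j) = 0 := by rw [hv, if_neg (by omega)]
    simp only [map_sub, LinearMap.sub_apply, hju, huj, huu, hjj]
    norm_num
  · rw [act, map_sub, map_sub, LinearMap.sub_apply, huτ, sub_zero]

/-- A nonzero solution of the quadratic equations is obtained from `|0⟩` by non-isotropic vectors
of `W`: apply the `v_j` with `j < 0` that do not kill it one after the other. -/
theorem exists_list_of_casimir (hv : IsSplitBasis B v) {I : Set ℤ} (hI : ∀ i ∈ I, -i ∈ I)
    (hI0 : ∀ i ≠ 0, i ∈ I) {W : Submodule ℂ V} (hW : ∀ w, w ∈ W ↔ ∀ k ∉ I, B w (v k) = 0)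
    (hpin : ∀ n ∈ W, B n n ≠ 0 → ∃ a ∈ conjStabilizer B W, (a : Cl B) = vec B n)
    {c : ℂ} {τ : F B v} (hτ0 : τ ≠ 0) (hτ : casimir B v I τ τ = c • (τ ⊗ₜ[ℂ] τ)) :
    ∃ l : List V, (∀ n ∈ l, n ∈ W ∧ B n n ≠ 0) ∧ ∃ d : ℂ, d ≠ 0 ∧
      τ = (d • (l.map (vec B)).prod) • vac B v := by
  obtain ⟨N, hN⟩ := exists_act_eq_zero hv τ
  induction N generalizing τ with
  | zero =>
    obtain ⟨d, rfl⟩ := exists_eq_smul_vac hv fun j hj => hN j (by simpa using hj)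
    refine ⟨[], by simp, d, ?_, by simp⟩
    rintro rfl
    exact hτ0 (zero_smul _ _)
  | succ N ih =>
    set j : ℤ := -((N : ℤ) + 1) with hj
    by_cases h0 : act B v (v j) τ = 0
    · refine ih hτ0 hτ fun i hi => ?_
      rcases eq_or_ne i j with rfl | hij
      · exact h0
      · exact hN i (by omega)
    · obtain ⟨n, hnW, hn, hnτ⟩ :=
        exists_vec_smul_eq_act hv hI hW hτ (hI0 j (by omega)) (by omega) h0
      have hn0 : B n n ≠ 0 := by rw [hn]; norm_num
      obtain ⟨a, ha, han⟩ := hpin n hnW hn0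
      have hτ' := casimir_self_smul hv hI hW ha hτ
      have haτ : (a : Cl B) • τ = act B v (v j) τ := by rw [← hnτ, han]; rfl
      rw [haτ] at hτ'
      obtain ⟨l, hl, d, hd, h⟩ := ih h0 hτ' fun i hi => by
        rcases eq_or_ne i j with rfl | hij
        · exact act_act_self_of_ne_zero hv (by omega) τ
        · rw [act_act_eq_neg hv (by omega), hN i (by omega), map_zero, neg_zero]
      refine ⟨n :: l, ?_, -d, neg_ne_zero.2 hd, ?_⟩
      · rintro m hm
        rcases List.mem_cons.1 hm with rfl | hm
        · exact ⟨hnW, hn0⟩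
        · exact hl m hm
      -- `n² = -1`
      have hτn : τ = -(vec B n • (vec B n • τ)) := by
        rw [smul_smul, vec_mul_self, hn, algebraMap_smul]
        norm_num
      have hnτ' : vec B n • τ = act B v (v j) τ := hnτ
      rw [hτn, hnτ', h, smul_smul, List.map_cons, List.prod_cons, mul_smul_comm, neg_smul,
        neg_smul]

theorem sqrt_two_smul_act_zero_prod (hv : IsSplitBasis B v) {l : List V}
    (hl : ∀ n ∈ l, n ∈ V' B v) :
    -(Real.sqrt 2 : ℂ) • act B v (v 0) ((l.map (vec B)).prod • vac B v) =
      (-1 : ℂ) ^ l.length • ((l.map (vec B)).prod • vac B v) := by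
  induction l with
  | nil =>
    simp only [List.map_nil, List.prod_nil, one_smul, List.length_nil, pow_zero]
    rw [neg_smul, sqrt_two_smul_act_zero_vac, neg_neg]
  | cons n l ih =>
    have h := act_act_add_swap hv.isSymm (v 0) n ((l.map (vec B)).prod • vac B v)
    have h0 : B (v 0) n = 0 := by
      rw [← mem_V'.1 (hl n List.mem_cons_self), ← hv.isSymm.eq]
    rw [h0, zero_smul] at h
    have hcons : (((n :: l).map (vec B)).prod • vac B v) =
        act B v n ((l.map (vec B)).prod • vac B v) := by
      rw [List.map_cons, List.prod_cons, mul_smul]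
      rfl
    rw [hcons, eq_neg_of_add_eq_zero_left h, smul_neg, ← map_smul,
      ih fun m hm => hl m (List.mem_cons_of_mem _ hm), map_smul, List.length_cons, pow_succ,
      mul_neg_one, neg_smul]

end Orbit

/-! ### The two orbits -/

section Main

variable {B : LinearMap.BilinForm ℂ V} {v : Module.Basis ℤ ℂ V}

theorem casimir_vac :
    casimir B v {0}ᶜ (vac B v) (vac B v) = 0 := by
  refine finsum_mem_eq_zero_of_forall_eq_zero fun i hi => ?_
  rcases lt_or_gt_of_ne (show i ≠ 0 from hi) with h | h
  · rw [act_vac_of_neg h, TensorProduct.zero_tmul]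
  · rw [act_vac_of_neg (j := -i) (by omega), TensorProduct.tmul_zero]

theorem casimir_act_one_vac (hv : IsSplitBasis B v) :
    casimir B v {0}ᶜ (act B v (v 1) (vac B v)) (act B v (v 1) (vac B v)) = 0 := by
  have hneg : ∀ j : ℤ, j < -1 → act B v (v j) (act B v (v 1) (vac B v)) = 0 := fun j hj => by
    rw [act_act_eq_neg hv (by omega), act_vac_of_neg (by omega), map_zero, neg_zero]
  have hone : act B v (v 1) (act B v (v 1) (vac B v)) = 0 :=
    act_act_self_of_ne_zero hv one_ne_zero _
  refine finsum_mem_eq_zero_of_forall_eq_zero fun i hi => ?_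
  rcases (by have : i ≠ 0 := hi; omega : i = 1 ∨ i < -1 ∨ -i = 1 ∨ -i < -1) with h | h | h | h
  · rw [h, hone, TensorProduct.zero_tmul]
  · rw [hneg i h, TensorProduct.zero_tmul]
  · rw [h, hone, TensorProduct.tmul_zero]
  · rw [hneg _ h, TensorProduct.tmul_zero]

theorem casimir_vacuum (hv : IsSplitBasis B v) (ν : ZMod 2) :
    casimir B v {0}ᶜ (vacuum B v ν) (vacuum B v ν) = 0 := by
  unfold vacuum
  split_ifs
  · exact casimir_vac
  · exact casimir_act_one_vac hv

theorem S_vac (hv : IsSplitBasis B v) :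
    S hv (vac B v ⊗ₜ[ℂ] vac B v) = (1 / 2 : ℂ) • (vac B v ⊗ₜ[ℂ] vac B v) := by
  rw [S, LinearMap.add_apply, S'_tmul, casimir_vac, add_zero, TensorProduct.map_tmul,
    act_zero_vac, TensorProduct.tmul_smul, ← TensorProduct.smul_tmul', smul_smul]
  congr 1
  linear_combination (1 / 4 : ℂ) * sqrt_two_sq

theorem mem_top_iff_univ (w : V) :
    w ∈ (⊤ : Submodule ℂ V) ↔ ∀ k ∉ (Set.univ : Set ℤ), B w (v k) = 0 := by
  simp

theorem mem_V'_iff_compl (w : V) : w ∈ V' B v ↔ ∀ k ∉ ({0}ᶜ : Set ℤ), B w (v k) = 0 := by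
  rw [mem_V']
  simp

theorem neg_mem_compl_zero (i : ℤ) (hi : i ∈ ({0}ᶜ : Set ℤ)) : -i ∈ ({0}ᶜ : Set ℤ) := by
  simpa using hi

theorem mem_orbit_iff (hv : IsSplitBasis B v) {τ : F B v} (hτ : τ ≠ 0) :
    τ ∈ orbit B v ↔ S hv (τ ⊗ₜ[ℂ] τ) = (1 / 2 : ℂ) • (τ ⊗ₜ[ℂ] τ) := by
  constructor
  · rintro ⟨⟨a, ha, _⟩, rfl⟩
    have h := S_vac hv
    rw [S_tmul] at h ⊢
    exact casimir_self_smul hv (I := Set.univ) (fun _ _ => trivial) mem_top_iff_univ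
      (pin_le_conjStabilizer ha) h
  · intro h
    rw [S_tmul] at h
    obtain ⟨l, hl, d, hd, rfl⟩ := exists_list_of_casimir hv (I := Set.univ) (W := ⊤)
      (fun _ _ => trivial) (fun _ _ => trivial) mem_top_iff_univ (fun n _ hn => by
        obtain ⟨a, ha, ha'⟩ := exists_mem_pin_of_vec hv.isSymm hn
        exact ⟨a, pin_le_conjStabilizer ha, ha'⟩) hτ h
    rcases Nat.even_or_odd l.length with hlen | hlen
    · obtain ⟨a, ha, ha'⟩ := exists_mem_spin_of_list hv.isSymm (fun n hn => (hl n hn).2) hlen hd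
      exact ⟨⟨a, ha⟩, by rw [← ha']; rfl⟩
    · -- an odd product is made even by `v₀`, for which `|0⟩` is an eigenvector
      have h00 : B (v 0) (v 0) ≠ 0 := by rw [hv, if_pos (by simp)]; exact one_ne_zero
      have h2 : (Real.sqrt 2 : ℂ) ≠ 0 := fun h => by simpa [h] using sqrt_two_sq
      obtain ⟨a, ha, ha'⟩ := exists_mem_spin_of_list hv.isSymm (l := l ++ [v 0])
        (fun n hn => by
          rcases List.mem_append.1 hn with hn | hn
          · exact (hl n hn).2
          · rw [List.mem_singleton.1 hn]; exact h00)
        (by simpa using hlen.add_one) (mul_ne_zero hd (neg_ne_zero.2 h2))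
      refine ⟨⟨a, ha⟩, ?_⟩
      change (a : Cl B) • vac B v = _
      have hv0 : vec B (v 0) • vac B v = -((Real.sqrt 2 : ℂ) / 2) • vac B v := act_zero_vac
      rw [ha', List.map_append, List.prod_append, List.map_singleton, List.prod_singleton,
        smul_assoc, mul_smul (l.map (vec B)).prod, hv0, smul_comm (l.map (vec B)).prod, smul_smul,
        smul_assoc]
      congr 1
      linear_combination (d / 2) * sqrt_two_sq

theorem mem_orbit'_iff (hv : IsSplitBasis B v) {ν : ZMod 2} {τ : F B v}
    (hν : τ ∈ halfSpin B v ν) (hτ : τ ≠ 0) :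
    τ ∈ orbit' B v ν ↔ S' hv (τ ⊗ₜ[ℂ] τ) = 0 := by
  constructor
  · rintro ⟨⟨_, a, ha, rfl⟩, rfl⟩
    have h := casimir_self_smul hv neg_mem_compl_zero mem_V'_iff_compl
      (pin_restrict_map_le_conjStabilizer (V' B v) ⟨a, ha.1, rfl⟩) (c := 0)
      (by rw [casimir_vacuum hv ν, zero_smul])
    rw [zero_smul] at h
    rw [S'_tmul]
    exact h
  · intro h
    rw [S'_tmul] at h
    obtain ⟨l, hl, d, hd, rfl⟩ := exists_list_of_casimir hv neg_mem_compl_zero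
      (fun _ hi => hi) mem_V'_iff_compl (fun n hn hn0 => by
        obtain ⟨a, ha, ha'⟩ := exists_mem_pin_of_vec (isSymm_restrict hv.isSymm (V' B v))
          (n := ⟨n, hn⟩) hn0
        refine ⟨_, pin_restrict_map_le_conjStabilizer (V' B v) ⟨a, ha, rfl⟩, ?_⟩
        change clIncl B (V' B v) (a : Cl (B.restrict (V' B v))) = _
        rw [ha', clIncl_vec]) (c := 0) hτ (by rw [h, zero_smul])
    -- the number of vectors has the parity of `ν`
    have hpar : (-1 : ℂ) ^ l.length = (-1 : ℂ) ^ ν.val := by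
      have h1 := sqrt_two_smul_act_zero_prod hv fun n hn => (hl n hn).1
      have h2 : -(Real.sqrt 2 : ℂ) • act B v (v 0) ((d • (l.map (vec B)).prod) • vac B v) =
        (-1 : ℂ) ^ ν.val • ((d • (l.map (vec B)).prod) • vac B v) := hν
      rw [smul_assoc, map_smul, smul_comm, h1, smul_comm, ← smul_assoc d] at h2
      exact smul_left_injective ℂ hτ h2
    rcases Nat.even_or_odd l.length with hlen | hlen
    · have hν0 : ν = 0 := by
        rw [hlen.neg_one_pow] at hpar
        fin_cases ν
        · rfl
        · exfalso; revert hpar; norm_num [ZMod.val]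
      obtain ⟨a, ha, ha'⟩ := exists_mem_spinSub_of_list hv.isSymm _ hl hlen hd
      refine ⟨⟨a, ha⟩, ?_⟩
      change (a : Cl B) • vacuum B v ν = _
      rw [vacuum, if_pos hν0, ha']
    · have hν1 : ν ≠ 0 := by
        rintro rfl
        rw [hlen.neg_one_pow] at hpar
        revert hpar
        norm_num
      -- `|0⟩ = (v₁ + v₋₁) |1⟩`
      have hm0 : B (v 1 + v (-1)) (v 1 + v (-1)) = 2 := by
        simp only [map_add, LinearMap.add_apply, hv _ _]
        norm_num
      have hmV : v 1 + v (-1) ∈ V' B v := by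
        rw [mem_V', map_add, LinearMap.add_apply, hv, hv]
        norm_num
      have hm : vec B (v 1 + v (-1)) • act B v (v 1) (vac B v) = vac B v := by
        have h1 := act_act_self_of_ne_zero hv one_ne_zero (vac B v)
        have h2 := act_act_add_swap hv.isSymm (v (-1)) (v 1) (vac B v)
        rw [act_vac_of_neg (j := -1) (by norm_num), map_zero, add_zero, hv, if_pos rfl,
          one_smul] at h2
        rw [map_add, add_smul]
        calc _ = act B v (v 1) (act B v (v 1) (vac B v)) +
              act B v (v (-1)) (act B v (v 1) (vac B v)) := rfl
          _ = _ := by rw [h1, h2, zero_add]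
      obtain ⟨a, ha, ha'⟩ := exists_mem_spinSub_of_list hv.isSymm (V' B v)
        (l := l ++ [v 1 + v (-1)])
        (fun n hn => by
          rcases List.mem_append.1 hn with hn | hn
          · exact hl n hn
          · rw [List.mem_singleton.1 hn, hm0]; exact ⟨hmV, two_ne_zero⟩)
        (by simpa using hlen.add_one) hd
      refine ⟨⟨a, ha⟩, ?_⟩
      change (a : Cl B) • vacuum B v ν = _
      rw [vacuum, if_neg hν1, ha', List.map_append, List.prod_append, List.map_singleton,
        List.prod_singleton, smul_assoc, mul_smul, hm, smul_assoc]

end Main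

end

end SpinModule

theorem theorem1p8 {V : Type*} [AddCommGroup V] [Module ℂ V]
    (B : LinearMap.BilinForm ℂ V) (v : Module.Basis ℤ ℂ V) (hv : SpinModule.IsSplitBasis B v) :
    (∀ τ : SpinModule.F B v, τ ≠ 0 →
      (τ ∈ SpinModule.orbit B v ↔
        SpinModule.S hv (τ ⊗ₜ[ℂ] τ) = (1 / 2 : ℂ) • (τ ⊗ₜ[ℂ] τ))) ∧
    (∀ (ν : ZMod 2) (τ : SpinModule.F B v), τ ∈ SpinModule.halfSpin B v ν → τ ≠ 0 →
      (τ ∈ SpinModule.orbit' B v ν ↔ SpinModule.S' hv (τ ⊗ₜ[ℂ] τ) = 0)) := by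
  exact ⟨fun _ hτ => SpinModule.mem_orbit_iff hv hτ,
    fun _ _ hν hτ => SpinModule.mem_orbit'_iff hv hν hτ⟩
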